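/- Let $M$ be a nonempty compact smooth manifold of dimension $n\ge 1$ (without boundary), let $g$ be a smooth Riemannian metric on $M$, let $v\in C^\infty(M)$ be positive, and let $m\in[0,\infty)$. For such data (a compact smooth metric measure space $(M^n,g,v^m\,\mathrm{dvol}_g)$), define the weighted scalar curvature $$R_\phi^m[g,v] = R_g - 2m\,v^{-1}\Delta_g v - m(m-1)\,v^{-2}|\nabla v|_g^2 ,$$ where $\Delta_g=\operatorname{tr}_g\nabla^2$, and, for $\mu\in\mathbb R$, the energy functional $$\mathcal W_\mu^m(g,v)=\int_M\left(R_\phi^m[g,v]+m\mu v^{-2}\right)v^m\,\mathrm{dvol}_g .$$ For a positive $u\in C^\infty(M)$ write $\hat g=u^{-2}g$ and $\hat v=u^{-1}v$, so that $\hat v^m\,\mathrm{dvol}_{\hat g}=u^{-m-n}v^m\,\mathrm{dvol}_g$. The weighted Yamabe constant is $$\sigma=\inf_{0<u\in C^\infty(M)}\frac{\left(\int_M R_\phi^m[\hat g,\hat v]\,\hat v^m\,\mathrm{dvol}_{\hat g}\right)\left(\int_M\hat v^{m-2}\,\mathrm{dvol}_{\hat g}\right)^{m/n}}{\left(\int_M\hat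 v^m\,\mathrm{dvol}_{\hat g}\right)^{(m+n-2)/n}}\in[-\infty,\infty),$$ the $(m,\mu)$-energy is $$\lambda(g,v,\mu)=\inf\left\{\mathcal W_\mu^m(\hat g,\hat v) : 0<u\in C^\infty(M),\ \int_M\hat v^m\,\mathrm{dvol}_{\hat g}=1\right\},$$ and the $m$-energy is $$\lambda=\inf_{\tau>0}\lambda(g,\sqrt\tau\,v,1)\in[-\infty,\infty).$$ Then: * if $\sigma<0$ and $m>0$, then $\lambda=-\infty$; * if $\sigma=0$, then $\lambda=0$; * if $\sigma>0$, then $\lambda=(m+n)\left(\dfrac{\sigma}{n}\right)^{\frac{n}{m+n}}$. -/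

import Mathlib

open scoped Manifold ContDiff
open MeasureTheory

noncomputable section

namespace WeightedYamabe

/-! ### A Borel family of reference charts on a compact manifold -/

/-- On a compact manifold one can choose, for every point `x`, one of finitely many charts around
`x`, in a Borel measurable way and so that the points which are assigned a given chart stay in a
compact part of the domain of that chart. -/
theorem exists_chartSelection (H M : Type*) [TopologicalSpace H] [TopologicalSpace M]
    [ChartedSpace H M] [LocallyCompactSpace M] [CompactSpace M] [T2Space M]
    [MeasurableSpace M] [BorelSpace M] :
    ∃ c : M → M, (Set.range c).Finite ∧ ∀ p, MeasurableSet (c ⁻¹' {p}) ∧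
      ∃ K, IsCompact K ∧ c ⁻¹' {p} ⊆ K ∧ K ⊆ (chartAt H p).source := by
  classical
  have h1 : ∀ x : M, ∃ K ∈ nhds x, K ⊆ (chartAt H x).source ∧ IsCompact K := fun x =>
    local_compact_nhds ((chartAt H x).open_source.mem_nhds (mem_chart_source H x))
  choose K hKn hKs hKc using h1
  obtain ⟨t, -, ht⟩ := isCompact_univ.elim_nhds_subcover K (fun x _ => hKn x)
  have key : ∀ l : List M, ∀ A : Set M, A ⊆ (⋃ p ∈ l, K p) → MeasurableSet A →
      ∃ c : M → M, (∀ x ∈ A, c x ∈ l ∧ x ∈ K (c x)) ∧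
        ∀ p, MeasurableSet (A ∩ c ⁻¹' {p}) := by
    intro l
    induction l with
    | nil =>
      intro A hA _
      refine ⟨id, fun x hx => ?_, fun p => ?_⟩
      · simpa using hA hx
      · have : A = ∅ := by simpa using hA
        simp [this]
    | cons q l ih =>
      intro A hA hm
      have hq : MeasurableSet (K q) := (hKc q).isClosed.measurableSet
      obtain ⟨c, hc, hcm⟩ := ih (A \ K q) (by
        intro x hx
        have := hA hx.1
        simp only [List.mem_cons, Set.mem_iUnion, exists_prop] at this ⊢
        obtain ⟨p, rfl | hp, hxp⟩ := this
        · exact absurd hxp hx.2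
        · exact ⟨p, hp, hxp⟩) (hm.diff hq)
      refine ⟨fun x => if x ∈ K q then q else c x, fun x hx => ?_, fun p => ?_⟩
      · by_cases hxq : x ∈ K q
        · simp [hxq]
        · have := hc x ⟨hx, hxq⟩
          simp only [hxq, if_false, List.mem_cons]
          exact ⟨Or.inr this.1, this.2⟩
      · have : A ∩ (fun x => if x ∈ K q then q else c x) ⁻¹' {p} =
            (if q = p then A ∩ K q else ∅) ∪ ((A \ K q) ∩ c ⁻¹' {p}) := by
          ext x
          by_cases hqp : q = p
          · subst hqp
            by_cases hxq : x ∈ K q <;> simp [hxq]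
          · by_cases hxq : x ∈ K q <;> simp [hxq, hqp]
        rw [this]
        refine MeasurableSet.union ?_ (hcm p)
        split_ifs
        · exact hm.inter hq
        · exact MeasurableSet.empty
  obtain ⟨c, hc, hcm⟩ := key t.toList Set.univ (by simpa using ht) MeasurableSet.univ
  refine ⟨c, t.finite_toSet.subset ?_, fun p => ⟨by simpa using hcm p, K p, hKc p, ?_, hKs p⟩⟩
  · rintro _ ⟨x, rfl⟩
    simpa using (hc x trivial).1
  · rintro x rfl
    exact (hc x trivial).2

variable {n : ℕ} {M : Type*} [TopologicalSpace M] [ChartedSpace (EuclideanSpace ℝ (Fin n)) M]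

section Selection

variable (n M) [CompactSpace M] [T2Space M] [MeasurableSpace M] [BorelSpace M]

/-- `refChart n M x` is the centre of the chart in which the geometry at the point `x` is computed;
by `exists_chartSelection` the point `x` lies in the domain of `chartAt _ (refChart n M x)`.
The quantities below do not depend on this choice of coordinates. -/
def refChart : M → M :=
  haveI : LocallyCompactSpace M :=
    ChartedSpace.locallyCompactSpace (EuclideanSpace ℝ (Fin n)) M
  (exists_chartSelection (EuclideanSpace ℝ (Fin n)) M).choose

theorem refChart_spec : (Set.range (refChart n M)).Finite ∧
    ∀ p, MeasurableSet (refChart n M ⁻¹' {p}) ∧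
      ∃ K, IsCompact K ∧ refChart n M ⁻¹' {p} ⊆ K ∧
        K ⊆ (chartAt (EuclideanSpace ℝ (Fin n)) p).source :=
  haveI : LocallyCompactSpace M :=
    ChartedSpace.locallyCompactSpace (EuclideanSpace ℝ (Fin n)) M
  (exists_chartSelection (EuclideanSpace ℝ (Fin n)) M).choose_spec

end Selection

/-! ### Riemannian geometry in coordinates -/

/-- The partial derivative `∂ᵢ f (y)` of a function on `ℝⁿ`. -/
def pd (i : Fin n) (f : EuclideanSpace ℝ (Fin n) → ℝ) (y : EuclideanSpace ℝ (Fin n)) : ℝ :=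
  fderiv ℝ f y (EuclideanSpace.single i 1)

section Coordinates

/- Here `G` is a matrix-valued function on (an open subset of) `ℝⁿ`: a Riemannian metric in
coordinates. -/
variable (G : EuclideanSpace ℝ (Fin n) → Matrix (Fin n) (Fin n) ℝ)

/-- The Christoffel symbol `Γᵏᵢⱼ = ½ ∑ₗ Gᵏˡ (∂ᵢ Gⱼₗ + ∂ⱼ Gᵢₗ - ∂ₗ Gᵢⱼ)`. -/
def christoffel (k i j : Fin n) (y : EuclideanSpace ℝ (Fin n)) : ℝ :=
  (1 / 2 : ℝ) * ∑ l, (G y)⁻¹ k l *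
    (pd i (fun z => G z j l) y + pd j (fun z => G z i l) y - pd l (fun z => G z i j) y)

/-- The Ricci curvature
`Ricᵢⱼ = ∑ₖ (∂ₖ Γᵏᵢⱼ - ∂ⱼ Γᵏᵢₖ) + ∑ₖₗ (Γᵏₖₗ Γˡᵢⱼ - Γᵏⱼₗ Γˡᵢₖ)`. -/
def ricci (i j : Fin n) (y : EuclideanSpace ℝ (Fin n)) : ℝ :=
  (∑ k, (pd k (christoffel G k i j) y - pd j (christoffel G k i k) y)) +
    ∑ k, ∑ l, (christoffel G k k l y * christoffel G l i j y -
      christoffel G k j l y * christoffel G l i k y)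

/-- The scalar curvature `∑ᵢⱼ Gⁱʲ Ricᵢⱼ`. -/
def coordScalar (y : EuclideanSpace ℝ (Fin n)) : ℝ :=
  ∑ i, ∑ j, (G y)⁻¹ i j * ricci G i j y

/-- The Laplacian `Δf = ∑ᵢⱼ Gⁱʲ (∂ᵢ ∂ⱼ f - ∑ₖ Γᵏᵢⱼ ∂ₖ f)` (the trace of the Hessian). -/
def coordLaplacian (f : EuclideanSpace ℝ (Fin n) → ℝ) (y : EuclideanSpace ℝ (Fin n)) : ℝ :=
  ∑ i, ∑ j, (G y)⁻¹ i j * (pd i (pd j f) y - ∑ k, christoffel G k i j y * pd k f y)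

/-- The squared length of the gradient, `|∇f|² = ∑ᵢⱼ Gⁱʲ ∂ᵢ f ∂ⱼ f`. -/
def coordGradSq (f : EuclideanSpace ℝ (Fin n) → ℝ) (y : EuclideanSpace ℝ (Fin n)) : ℝ :=
  ∑ i, ∑ j, (G y)⁻¹ i j * pd i f y * pd j f y

end Coordinates

/-! ### Riemannian metrics on a manifold -/

section Metric

variable [IsManifold (𝓡 n) ∞ M]

variable (n M) in
/-- Smooth Riemannian metrics on the `n`-dimensional manifold `M`. -/
abbrev Metric : Type _ :=
  Bundle.ContMDiffRiemannianMetric (𝓡 n) ∞ (EuclideanSpace ℝ (Fin n))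
    (fun x : M => TangentSpace (𝓡 n) x)

/-- The matrix `Gᵢⱼ = g(∂ᵢ, ∂ⱼ)` of `g` in the chart around `p`, as a function of the
coordinates. -/
def metricMatrix (g : Metric n M) (p : M) (y : EuclideanSpace ℝ (Fin n)) :
    Matrix (Fin n) (Fin n) ℝ :=
  let D := mfderiv 𝓘(ℝ, EuclideanSpace ℝ (Fin n)) (𝓡 n) (extChartAt (𝓡 n) p).symm y
  Matrix.of fun i j => g.inner ((extChartAt (𝓡 n) p).symm y)
    (D (EuclideanSpace.single i (1 : ℝ))) (D (EuclideanSpace.single j (1 : ℝ)))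

/-- The Riemannian measure of `g` on the domain of the chart around `p`: it is `√(det G) dy` in the
coordinates `y`. -/
def chartVolume [MeasurableSpace M] (g : Metric n M) (p : M) : Measure M :=
  (((volume : Measure (EuclideanSpace ℝ (Fin n))).restrict (extChartAt (𝓡 n) p).target).withDensity
    (fun y => ENNReal.ofReal (Real.sqrt (metricMatrix g p y).det))).map (extChartAt (𝓡 n) p).symm

/-- The conformal metric `u⁻² g`. -/
def Metric.conformal (g : Metric n M) (u : M → ℝ) (hu : ContMDiff (𝓡 n) 𝓘(ℝ) ∞ u)
    (hpos : ∀ x, 0 < u x) : Metric n M where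
  inner x := ((u x) ^ 2)⁻¹ • g.inner x
  symm x a b := by
    change ((u x) ^ 2)⁻¹ * g.inner x a b = ((u x) ^ 2)⁻¹ * g.inner x b a
    rw [g.symm]
  pos x a ha := by
    change 0 < ((u x) ^ 2)⁻¹ * g.inner x a a
    have := g.pos x a ha
    have := hpos x
    positivity
  isVonNBounded x := by
    have hx := hpos x
    have h := (g.isVonNBounded x).image
      (u x • ContinuousLinearMap.id ℝ (TangentSpace (𝓡 n) x))
    refine h.subset ?_
    intro a ha
    refine (Set.mem_image _ _ _).mpr ⟨(u x)⁻¹ • a, ?_, ?_⟩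
    · have h1 : ((u x) ^ 2)⁻¹ * g.inner x a a < 1 := ha
      have h2 : g.inner x ((u x)⁻¹ • a) ((u x)⁻¹ • a) = ((u x) ^ 2)⁻¹ * g.inner x a a := by
        simp only [map_smul, smul_apply, smul_eq_mul]
        rw [pow_two, mul_inv, mul_assoc]
      change g.inner x ((u x)⁻¹ • a) ((u x)⁻¹ • a) < 1
      rw [h2]
      exact h1
    · change u x • (u x)⁻¹ • a = a
      rw [smul_smul, mul_inv_cancel₀ hx.ne', one_smul]
  contMDiff := by
    have h2 : ContMDiff (𝓡 n) 𝓘(ℝ) ∞ (fun x => ((u x) ^ 2)⁻¹) := by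
      have h3 : ContMDiff (𝓡 n) 𝓘(ℝ) ∞ (fun x => (u x) ^ 2) := hu.pow 2
      exact h3.inv₀ (fun x => pow_ne_zero 2 (hpos x).ne')
    exact h2.smul_section g.contMDiff

variable [CompactSpace M] [T2Space M] [MeasurableSpace M] [BorelSpace M]

/-- The Riemannian volume measure `dvol_g`: `M` is cut into the finitely many Borel pieces given by
the reference charts, and the volume of each piece is measured in its chart. -/
def riemVol (g : Metric n M) : Measure M :=
  Measure.sum fun p : M => (chartVolume g p).restrict (refChart n M ⁻¹' {p})

/-- The scalar curvature `R` of `g`. -/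
def scalarCurv (g : Metric n M) (x : M) : ℝ :=
  let p := refChart n M x
  coordScalar (metricMatrix g p) (extChartAt (𝓡 n) p x)

/-- The Laplace-Beltrami operator `Δ` of `g`. -/
def laplacian (g : Metric n M) (f : M → ℝ) (x : M) : ℝ :=
  let p := refChart n M x
  coordLaplacian (metricMatrix g p) (f ∘ (extChartAt (𝓡 n) p).symm) (extChartAt (𝓡 n) p x)

/-- The squared length `|∇f|²` of the gradient of `f` with respect to `g`. -/
def gradSq (g : Metric n M) (f : M → ℝ) (x : M) : ℝ :=
  let p := refChart n M x
  coordGradSq (metricMatrix g p) (f ∘ (extChartAt (𝓡 n) p).symm) (extChartAt (𝓡 n) p x)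

end Metric

/-! ### Smooth metric measure spaces -/

variable (n M) in
/-- A smooth metric measure space `(M, g, vᵐ dvol, m)` on the manifold `M`, with finite dimensional
parameter `m`. -/
structure SMMS [IsManifold (𝓡 n) ∞ M] where
  g : Metric n M
  v : M → ℝ
  v_smooth : ContMDiff (𝓡 n) 𝓘(ℝ) ∞ v
  v_pos : ∀ x, 0 < v x
  m : ℝ

variable (n M) in
/-- Positive smooth functions on `M`. -/
structure PosSmooth where
  toFun : M → ℝ
  smooth : ContMDiff (𝓡 n) 𝓘(ℝ) ∞ toFun
  pos : ∀ x, 0 < toFun x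

namespace SMMS

variable [IsManifold (𝓡 n) ∞ M]

/-- The conformally equivalent SMMS `(M, u⁻² g, u⁻ᵐ⁻ⁿ vᵐ dvol_g) = (M, ĝ, v̂ᵐ dvol_ĝ)`, that is,
`ĝ = u⁻² g` and `v̂ = u⁻¹ v`. -/
def conformal (S : SMMS n M) (u : PosSmooth n M) : SMMS n M where
  g := S.g.conformal u.toFun u.smooth u.pos
  v x := (u.toFun x)⁻¹ * S.v x
  v_smooth := (u.smooth.inv₀ (fun x => (u.pos x).ne')).mul S.v_smooth
  v_pos x := mul_pos (inv_pos.mpr (u.pos x)) (S.v_pos x)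
  m := S.m

/-- The SMMS `(M, g, (k v)ᵐ dvol_g)` for a constant `k > 0`. -/
def rescale (S : SMMS n M) (k : ℝ) (hk : 0 < k) : SMMS n M where
  g := S.g
  v x := k * S.v x
  v_smooth := contMDiff_const.mul S.v_smooth
  v_pos x := mul_pos hk (S.v_pos x)
  m := S.m

variable [CompactSpace M] [T2Space M] [MeasurableSpace M] [BorelSpace M]

/-- The weighted scalar curvature `R_φ^m = R - 2 m v⁻¹ Δv - m (m - 1) v⁻² |∇v|²`. -/
def weightedScalar (S : SMMS n M) (x : M) : ℝ :=
  scalarCurv S.g x - 2 * S.m * (S.v x)⁻¹ * laplacian S.g S.v x -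
    S.m * (S.m - 1) * ((S.v x) ^ 2)⁻¹ * gradSq S.g S.v x

/-- The weighted volume `∫ vᵐ dvol`. -/
def weightedVol (S : SMMS n M) : ℝ :=
  ∫ x, (S.v x) ^ S.m ∂(riemVol S.g)

/-- The integral `∫ vᵐ⁻² dvol`. -/
def weightedVol₂ (S : SMMS n M) : ℝ :=
  ∫ x, (S.v x) ^ (S.m - 2) ∂(riemVol S.g)

/-- The total weighted scalar curvature `∫ R_φ^m vᵐ dvol`. -/
def totalScalar (S : SMMS n M) : ℝ :=
  ∫ x, S.weightedScalar x * (S.v x) ^ S.m ∂(riemVol S.g)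

/-- The `(m, μ)`-energy functional `𝒲 = ∫ (R_φ^m + m μ v⁻²) vᵐ dvol`. -/
def energyFunctional (S : SMMS n M) (μ : ℝ) : ℝ :=
  ∫ x, (S.weightedScalar x + S.m * μ * ((S.v x) ^ 2)⁻¹) * (S.v x) ^ S.m ∂(riemVol S.g)

/-- The quotient
`(∫ R_φ^m vᵐ dvol) (∫ vᵐ⁻² dvol)^(m/n) / (∫ vᵐ dvol)^((m+n-2)/n)`. -/
def yamabeQuotient (S : SMMS n M) : ℝ :=
  S.totalScalar * S.weightedVol₂ ^ (S.m / n) / S.weightedVol ^ ((S.m + n - 2) / n)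

/-- The weighted Yamabe constant `σ₁,₂`: the infimum of the quotient over the conformal class. -/
def weightedYamabe (S : SMMS n M) : EReal :=
  ⨅ u : PosSmooth n M, ((S.conformal u).yamabeQuotient : EReal)

/-- The `(m, μ)`-energy: the infimum of the energy functional over the conformal class, among the
conformally equivalent SMMS of weighted volume one. -/
def muEnergy (S : SMMS n M) (μ : ℝ) : EReal :=
  ⨅ (u : PosSmooth n M) (_ : (S.conformal u).weightedVol = 1),
    ((S.conformal u).energyFunctional μ : EReal)

/-- The `m`-energy `inf_{τ > 0} λ(g, (√τ v)ᵐ dvol, 1)`. -/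
def mEnergy (S : SMMS n M) : EReal :=
  ⨅ (τ : ℝ) (hτ : 0 < τ), (S.rescale (Real.sqrt τ) (Real.sqrt_pos.mpr hτ)).muEnergy 1

end SMMS

end WeightedYamabe

end

noncomputable section

namespace WeightedYamabe

section

section Coordinates

variable {n : ℕ}

/-! ### Scaling a metric in coordinates by a constant -/

/-! Within a conformal class, the pairs `(g, v)` reached by varying both the conformal factor and
`τ` can be rescaled independently by constants: `g` by `c⁻²` and `v` by `b`. Write `A`, `B`, `C` for
the integrals of `R_φ^m v^m`, `v^(m-2)` and `v^m`. Under this rescaling each is multiplied by an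
explicit power product. Normalizing the weighted volume forces `c^n = b^m C`, and the energy becomes
`Q x^(m/n) + m/x`, where `Q` is the scale-invariant Yamabe quotient and `x = b² C / B` ranges over
all positive reals. Hence the `m`-energy is the infimum of `Q(u) x^(m/n) + m/x` over `u` and `x > 0`
(`mEnergy_eq_iInf`). The rest is calculus in `x`: for some `Q < 0` and `m > 0` let `x → ∞`;
otherwise weighted AM-GM gives the sharp lower bound (`le_mul_rpow_add_div`), attained at an
explicit `x` when `σ > 0` and approached as `x → ∞` when `σ = 0`. The analytic input is that the
integrals split and are positive: the measure is finite and nonzero, and the integrands are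
integrable. -/

theorem pd_const_mul (i : Fin n) (a : ℝ) (f : EuclideanSpace ℝ (Fin n) → ℝ) :
    pd i (fun z => a * f z) = fun y => a * pd i f y := by
  funext y
  have h : (fun z => a * f z) = a • f := rfl
  rw [pd, h, fderiv_const_smul_field]
  rfl

theorem matrix_inv_const_smul {a : ℝ} (ha : a ≠ 0) (A : Matrix (Fin n) (Fin n) ℝ) :
    (a • A)⁻¹ = a⁻¹ • A⁻¹ := by
  by_cases h : IsUnit A.det
  · refine Matrix.inv_eq_left_inv ?_
    rw [Matrix.smul_mul, Matrix.mul_smul, smul_smul, inv_mul_cancel₀ ha, one_smul,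
      Matrix.nonsing_inv_mul _ h]
  · have h' : ¬ IsUnit (a • A).det := by
      rw [Matrix.det_smul]
      simpa [ha] using h
    rw [Matrix.nonsing_inv_apply_not_isUnit _ h, Matrix.nonsing_inv_apply_not_isUnit _ h', smul_zero]

variable {G G' : EuclideanSpace ℝ (Fin n) → Matrix (Fin n) (Fin n) ℝ} {a : ℝ}

/-- The factor `a` from the derivatives of the metric cancels the `a⁻¹` from its inverse. Curvature
and Laplacian therefore scale only through the final trace. No differentiability is needed, since
`fderiv` commutes with constant multiples even at its default value `0`. -/
theorem christoffel_const_smul (ha : a ≠ 0) (h : ∀ y, G' y = a • G y) (k i j : Fin n) :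
    christoffel G' k i j = christoffel G k i j := by
  have hG : ∀ i j, (fun z => G' z i j) = fun z => a * G z i j := fun i j => by
    funext z; rw [h]; rfl
  funext y
  simp only [christoffel, hG, pd_const_mul]
  rw [h, matrix_inv_const_smul ha]
  congr 1
  refine Finset.sum_congr rfl fun l _ => ?_
  rw [Matrix.smul_apply, smul_eq_mul]
  field_simp

theorem ricci_const_smul (ha : a ≠ 0) (h : ∀ y, G' y = a • G y) (i j : Fin n) :
    ricci G' i j = ricci G i j := by
  funext y
  simp only [ricci, christoffel_const_smul ha h]

theorem coordScalar_const_smul (ha : a ≠ 0) (h : ∀ y, G' y = a • G y)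
    (y : EuclideanSpace ℝ (Fin n)) : coordScalar G' y = a⁻¹ * coordScalar G y := by
  simp only [coordScalar, ricci_const_smul ha h, h, matrix_inv_const_smul ha, Matrix.smul_apply,
    smul_eq_mul, Finset.mul_sum, mul_assoc]

theorem coordLaplacian_const_smul (ha : a ≠ 0) (h : ∀ y, G' y = a • G y) (b : ℝ)
    (f : EuclideanSpace ℝ (Fin n) → ℝ) (y : EuclideanSpace ℝ (Fin n)) :
    coordLaplacian G' (fun z => b * f z) y = a⁻¹ * b * coordLaplacian G f y := by
  simp only [coordLaplacian, christoffel_const_smul ha h, h, matrix_inv_const_smul ha,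
    Matrix.smul_apply, smul_eq_mul, pd_const_mul, Finset.mul_sum]
  refine Finset.sum_congr rfl fun i _ => Finset.sum_congr rfl fun j _ => ?_
  simp only [mul_left_comm _ b, ← Finset.mul_sum]
  ring

theorem coordGradSq_const_smul (ha : a ≠ 0) (h : ∀ y, G' y = a • G y) (b : ℝ)
    (f : EuclideanSpace ℝ (Fin n) → ℝ) (y : EuclideanSpace ℝ (Fin n)) :
    coordGradSq G' (fun z => b * f z) y = a⁻¹ * b ^ 2 * coordGradSq G f y := by
  simp only [coordGradSq, h, matrix_inv_const_smul ha,
    Matrix.smul_apply, smul_eq_mul, pd_const_mul, Finset.mul_sum]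
  refine Finset.sum_congr rfl fun i _ => Finset.sum_congr rfl fun j _ => ?_
  ring

/-! ### Smoothness of the curvature quantities in coordinates -/

variable {U : Set (EuclideanSpace ℝ (Fin n))}

theorem contDiffOn_pd (hU : IsOpen U) {f : EuclideanSpace ℝ (Fin n) → ℝ} (hf : ContDiffOn ℝ ∞ f U)
    (i : Fin n) : ContDiffOn ℝ ∞ (pd i f) U :=
  (hf.fderiv_of_isOpen hU (by simp)).clm_apply contDiffOn_const

theorem contDiffOn_det (hG : ∀ i j, ContDiffOn ℝ ∞ (fun y => G y i j) U) :
    ContDiffOn ℝ ∞ (fun y => (G y).det) U := by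
  simp only [Matrix.det_apply']
  exact ContDiffOn.sum fun σ _ => contDiffOn_const.mul (contDiffOn_prod fun i _ => hG _ _)

theorem contDiffOn_matrix_inv (hG : ∀ i j, ContDiffOn ℝ ∞ (fun y => G y i j) U)
    (hdet : ∀ y ∈ U, (G y).det ≠ 0) (i j : Fin n) :
    ContDiffOn ℝ ∞ (fun y => (G y)⁻¹ i j) U := by
  simp only [Matrix.inv_def, Ring.inverse_eq_inv', Matrix.smul_apply, smul_eq_mul,
    Matrix.adjugate_apply]
  -- Cramer's rule: an adjugate entry is the determinant of `G` with row `j` replaced by a constant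
  -- unit vector.
  refine ((contDiffOn_det hG).inv hdet).mul (contDiffOn_det fun k l => ?_)
  by_cases hk : k = j
  · subst hk
    simpa using contDiffOn_const
  · simpa [Matrix.updateRow_ne hk] using hG k l

theorem contDiffOn_christoffel (hU : IsOpen U)
    (hG : ∀ i j, ContDiffOn ℝ ∞ (fun y => G y i j) U)
    (hdet : ∀ y ∈ U, (G y).det ≠ 0) (k i j : Fin n) :
    ContDiffOn ℝ ∞ (christoffel G k i j) U := by
  unfold christoffel
  exact contDiffOn_const.mul (ContDiffOn.sum fun l _ => (contDiffOn_matrix_inv hG hdet k l).mul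
    (((contDiffOn_pd hU (hG _ _) _).add (contDiffOn_pd hU (hG _ _) _)).sub
      (contDiffOn_pd hU (hG _ _) _)))

theorem contDiffOn_ricci (hU : IsOpen U)
    (hG : ∀ i j, ContDiffOn ℝ ∞ (fun y => G y i j) U)
    (hdet : ∀ y ∈ U, (G y).det ≠ 0) (i j : Fin n) : ContDiffOn ℝ ∞ (ricci G i j) U := by
  have h := contDiffOn_christoffel hU hG hdet
  unfold ricci
  exact (ContDiffOn.sum fun k _ => (contDiffOn_pd hU (h _ _ _) _).sub
    (contDiffOn_pd hU (h _ _ _) _)).add (ContDiffOn.sum fun k _ => ContDiffOn.sum fun l _ =>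
      ((h _ _ _).mul (h _ _ _)).sub ((h _ _ _).mul (h _ _ _)))

theorem contDiffOn_coordScalar (hU : IsOpen U)
    (hG : ∀ i j, ContDiffOn ℝ ∞ (fun y => G y i j) U)
    (hdet : ∀ y ∈ U, (G y).det ≠ 0) : ContDiffOn ℝ ∞ (coordScalar G) U :=
  ContDiffOn.sum fun i _ => ContDiffOn.sum fun j _ =>
    (contDiffOn_matrix_inv hG hdet i j).mul (contDiffOn_ricci hU hG hdet i j)

theorem contDiffOn_coordLaplacian (hU : IsOpen U)
    (hG : ∀ i j, ContDiffOn ℝ ∞ (fun y => G y i j) U)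
    (hdet : ∀ y ∈ U, (G y).det ≠ 0) {f : EuclideanSpace ℝ (Fin n) → ℝ}
    (hf : ContDiffOn ℝ ∞ f U) : ContDiffOn ℝ ∞ (coordLaplacian G f) U :=
  ContDiffOn.sum fun i _ => ContDiffOn.sum fun j _ =>
    (contDiffOn_matrix_inv hG hdet i j).mul ((contDiffOn_pd hU (contDiffOn_pd hU hf _) _).sub
      (ContDiffOn.sum fun k _ => (contDiffOn_christoffel hU hG hdet k i j).mul
        (contDiffOn_pd hU hf _)))

theorem contDiffOn_coordGradSq (hU : IsOpen U)
    (hG : ∀ i j, ContDiffOn ℝ ∞ (fun y => G y i j) U)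
    (hdet : ∀ y ∈ U, (G y).det ≠ 0) {f : EuclideanSpace ℝ (Fin n) → ℝ}
    (hf : ContDiffOn ℝ ∞ f U) : ContDiffOn ℝ ∞ (coordGradSq G f) U :=
  ContDiffOn.sum fun i _ => ContDiffOn.sum fun j _ =>
    ((contDiffOn_matrix_inv hG hdet i j).mul (contDiffOn_pd hU hf _)).mul (contDiffOn_pd hU hf _)

end Coordinates

end

section

variable {n : ℕ} {M : Type*} [TopologicalSpace M] [ChartedSpace (EuclideanSpace ℝ (Fin n)) M]

section Metric

variable [IsManifold (𝓡 n) ∞ M]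

/-! ### The metric in coordinates -/

/-- The coordinate field is the tangent map of the inverse chart applied to a constant section.
Feeding two such fields to the metric gives the smoothness of its matrix entries. -/
theorem contMDiffOn_coordVectorField (p : M) (e : EuclideanSpace ℝ (Fin n)) :
    ContMDiffOn 𝓘(ℝ, EuclideanSpace ℝ (Fin n)) (𝓡 n).tangent ∞
      (fun y => (Bundle.TotalSpace.mk' (EuclideanSpace ℝ (Fin n))
        (E := fun x : M => TangentSpace (𝓡 n) x) ((extChartAt (𝓡 n) p).symm y)
        (mfderiv 𝓘(ℝ, EuclideanSpace ℝ (Fin n)) (𝓡 n) (extChartAt (𝓡 n) p).symm y e)))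
      (extChartAt (𝓡 n) p).target := by
  have : IsManifold (𝓡 n) 1 M := IsManifold.of_le (n := ∞) (by simp)
  have h1 : ContMDiffOn 𝓘(ℝ, EuclideanSpace ℝ (Fin n)) (𝓡 n) ∞ (extChartAt (𝓡 n) p).symm
      (extChartAt (𝓡 n) p).target := contMDiffOn_extChartAt_symm p
  have hU := isOpen_extChartAt_target (I := 𝓡 n) p
  have h2 := h1.contMDiffOn_tangentMapWithin (m := ∞) (by simp) hU.uniqueMDiffOn
  have h3 : ContMDiffOn 𝓘(ℝ, EuclideanSpace ℝ (Fin n)) 𝓘(ℝ, EuclideanSpace ℝ (Fin n)).tangent ∞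
      (fun y => (⟨y, e⟩ : TangentBundle 𝓘(ℝ, EuclideanSpace ℝ (Fin n)) (EuclideanSpace ℝ (Fin n))))
      (extChartAt (𝓡 n) p).target :=
    contMDiffOn_vectorSpace_iff_contDiffOn.2 contDiffOn_const
  refine (h2.comp h3 fun y hy => hy).congr fun y hy => ?_
  simp only [Function.comp, tangentMapWithin, mfderivWithin_of_isOpen hU hy]

theorem contDiffOn_metricMatrix (g : Metric n M) (p : M) (i j : Fin n) :
    ContDiffOn ℝ ∞ (fun y => metricMatrix g p y i j) (extChartAt (𝓡 n) p).target := by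
  rw [← contMDiffOn_iff_contDiffOn]
  have h1 : ContMDiffOn 𝓘(ℝ, EuclideanSpace ℝ (Fin n)) (𝓡 n) ∞ (extChartAt (𝓡 n) p).symm
      (extChartAt (𝓡 n) p).target := contMDiffOn_extChartAt_symm p
  have hg := g.contMDiff.comp_contMDiffOn h1
  have h := ContMDiffOn.clm_bundle_apply₂ (F₃ := ℝ) (E₃ := fun _ : M => ℝ) hg
    (contMDiffOn_coordVectorField p (EuclideanSpace.single i (1 : ℝ)))
    (contMDiffOn_coordVectorField p (EuclideanSpace.single j (1 : ℝ)))
  intro y hy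
  have := h y hy
  rw [Bundle.contMDiffWithinAt_totalSpace] at this
  exact this.2

theorem dotProduct_mulVec_pullback {F : Type*} [AddCommGroup F] [Module ℝ F] [TopologicalSpace F]
    (B : F →L[ℝ] F →L[ℝ] ℝ) (D : EuclideanSpace ℝ (Fin n) →L[ℝ] F) (x : Fin n → ℝ) :
    dotProduct x ((Matrix.of fun i j => B (D (EuclideanSpace.single i (1 : ℝ)))
      (D (EuclideanSpace.single j (1 : ℝ)))).mulVec x) =
      B (D (WithLp.toLp 2 x)) (D (WithLp.toLp 2 x)) := by
  have h2 : (WithLp.toLp 2 x : EuclideanSpace ℝ (Fin n)) =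
      ∑ i, x i • EuclideanSpace.single i (1 : ℝ) := by
    ext k; simp [Finset.sum_apply, Pi.single_apply]
  rw [h2]
  simp only [map_sum, map_smul, sum_apply, smul_apply,
    dotProduct, Matrix.mulVec, smul_eq_mul, Finset.mul_sum, Matrix.of_apply]
  rw [Finset.sum_comm]
  refine Finset.sum_congr rfl fun a _ => Finset.sum_congr rfl fun b _ => ?_
  ring

theorem metricMatrix_posDef (g : Metric n M) (p : M) {y : EuclideanSpace ℝ (Fin n)}
    (hy : y ∈ (extChartAt (𝓡 n) p).target) : (metricMatrix g p y).PosDef := by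
  have : IsManifold (𝓡 n) 1 M := IsManifold.of_le (n := ∞) (by simp)
  refine Matrix.PosDef.of_dotProduct_mulVec_pos ?_ fun x hx => ?_
  · ext i j
    exact g.symm _ _ _
  · set D := mfderiv 𝓘(ℝ, EuclideanSpace ℝ (Fin n)) (𝓡 n) (extChartAt (𝓡 n) p).symm y with hD
    have hinj : Function.Injective D := by
      have := isInvertible_mfderivWithin_extChartAt_symm (I := 𝓡 n) hy
      rw [ModelWithCorners.range_eq_univ, mfderivWithin_univ] at this
      exact this.injective
    have hx' : (WithLp.toLp 2 x : EuclideanSpace ℝ (Fin n)) ≠ 0 := by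
      intro h; apply hx; simpa using congrArg WithLp.ofLp h
    have h0 : D (WithLp.toLp 2 x) ≠ 0 := fun h => hx' (hinj (h.trans (map_zero D).symm))
    have h1 := g.pos _ _ h0
    exact lt_of_lt_of_eq h1 (dotProduct_mulVec_pullback (g.inner _) D x).symm

theorem metricMatrix_det_pos (g : Metric n M) (p : M) {y : EuclideanSpace ℝ (Fin n)}
    (hy : y ∈ (extChartAt (𝓡 n) p).target) : 0 < (metricMatrix g p y).det :=
  (metricMatrix_posDef g p hy).det_pos

end Metric

end

section

variable {n : ℕ} {M : Type*} [TopologicalSpace M] [ChartedSpace (EuclideanSpace ℝ (Fin n)) M]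

section Selection

variable [CompactSpace M] [T2Space M] [MeasurableSpace M] [BorelSpace M]

theorem measurableSet_refChart (p : M) : MeasurableSet (refChart n M ⁻¹' {p}) :=
  ((refChart_spec n M).2 p).1

theorem preimage_refChart_subset (p : M) :
    refChart n M ⁻¹' {p} ⊆ (chartAt (EuclideanSpace ℝ (Fin n)) p).source := by
  obtain ⟨-, K, -, h1, h2⟩ := (refChart_spec n M).2 p
  exact h1.trans h2

end Selection

section Metric

variable [IsManifold (𝓡 n) ∞ M]

/-! ### The Riemannian measure -/

theorem continuousOn_sqrt_det (g : Metric n M) (p : M) :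
    ContinuousOn (fun y => Real.sqrt (metricMatrix g p y).det) (extChartAt (𝓡 n) p).target :=
  (contDiffOn_det (contDiffOn_metricMatrix g p)).continuousOn.sqrt

theorem aemeasurable_density (g : Metric n M) (p : M) :
    AEMeasurable (fun y => ENNReal.ofReal (Real.sqrt (metricMatrix g p y).det))
      ((volume : Measure (EuclideanSpace ℝ (Fin n))).restrict (extChartAt (𝓡 n) p).target) :=
  ((continuousOn_sqrt_det g p).aemeasurable
    (isOpen_extChartAt_target p).measurableSet).ennreal_ofReal

variable [MeasurableSpace M]

theorem chartVolume_apply [BorelSpace M] (g : Metric n M) (p : M) {s : Set M}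
    (hs : MeasurableSet s) :
    chartVolume g p s =
      (((volume : Measure (EuclideanSpace ℝ (Fin n))).restrict
        (extChartAt (𝓡 n) p).target).withDensity
          (fun y => ENNReal.ofReal (Real.sqrt (metricMatrix g p y).det)))
        ((extChartAt (𝓡 n) p).symm ⁻¹' s) := by
  refine Measure.map_apply_of_aemeasurable ?_ hs
  exact ((continuousOn_extChartAt_symm p).aemeasurable
    (isOpen_extChartAt_target p).measurableSet).mono_ac (withDensity_absolutelyContinuous _ _)

theorem chartVolume_lt_top [BorelSpace M] [T2Space M] (g : Metric n M) (p : M) {K : Set M}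
    (hK : IsCompact K) (hKs : K ⊆ (chartAt (EuclideanSpace ℝ (Fin n)) p).source) :
    chartVolume g p K < ⊤ := by
  rw [← extChartAt_source (𝓡 n)] at hKs
  rw [chartVolume_apply g p hK.measurableSet, withDensity_apply',
    Measure.restrict_restrict' (isOpen_extChartAt_target p).measurableSet]
  have h1 : (extChartAt (𝓡 n) p).symm ⁻¹' K ∩ (extChartAt (𝓡 n) p).target ⊆
      extChartAt (𝓡 n) p '' K := fun y hy => ⟨_, hy.1, (extChartAt (𝓡 n) p).right_inv hy.2⟩
  have h2 : extChartAt (𝓡 n) p '' K ⊆ (extChartAt (𝓡 n) p).target := by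
    rintro _ ⟨x, hx, rfl⟩
    exact (extChartAt (𝓡 n) p).map_source (hKs hx)
  have h3 : IsCompact (extChartAt (𝓡 n) p '' K) :=
    hK.image_of_continuousOn ((continuousOn_extChartAt p).mono hKs)
  refine (lintegral_mono_set h1).trans_lt ?_
  exact (((continuousOn_sqrt_det g p).mono h2).integrableOn_compact h3).lintegral_lt_top

theorem volume_eq_zero_of_chartVolume_eq_zero [BorelSpace M] (g : Metric n M) (p : M) {s : Set M}
    (hs : MeasurableSet s) (h : chartVolume g p s = 0) :
    (volume : Measure (EuclideanSpace ℝ (Fin n)))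
      ((extChartAt (𝓡 n) p).symm ⁻¹' s ∩ (extChartAt (𝓡 n) p).target) = 0 := by
  have hm := (isOpen_extChartAt_target (I := 𝓡 n) p).measurableSet
  rw [chartVolume_apply g p hs] at h
  rw [← Measure.restrict_apply' hm]
  refine withDensity_absolutelyContinuous' (aemeasurable_density g p) ?_ h
  refine (ae_restrict_iff' hm).2 (Filter.Eventually.of_forall fun y hy => ?_)
  simpa using metricMatrix_det_pos g p hy

variable [CompactSpace M] [T2Space M] [BorelSpace M]

theorem chartVolume_refChart_lt_top (g : Metric n M) (p : M) :
    chartVolume g p (refChart n M ⁻¹' {p}) < ⊤ := by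
  obtain ⟨-, K, hK, h1, h2⟩ := (refChart_spec n M).2 p
  exact (measure_mono h1).trans_lt (chartVolume_lt_top g p hK h2)

instance isFiniteMeasure_riemVol (g : Metric n M) : IsFiniteMeasure (riemVol g) := by
  refine ⟨?_⟩
  rw [riemVol, Measure.sum_apply _ MeasurableSet.univ]
  simp only [Measure.restrict_apply_univ]
  rw [tsum_eq_sum (s := (refChart_spec n M).1.toFinset)]
  · exact ENNReal.sum_lt_top.2 fun p _ => chartVolume_refChart_lt_top g p
  · intro p hp
    have : refChart n M ⁻¹' {p} = ∅ := by
      rw [Set.preimage_singleton_eq_empty]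
      simpa using hp
    rw [this, measure_empty]

/-- If the measure vanished, every piece would be Lebesgue-null in its own chart, because the
density is positive. Smooth transition maps preserve null sets, so the target of a single chart, a
nonempty open set, would be a finite union of null sets. Independence of the measure from the charts
is not needed. -/
theorem riemVol_ne_zero [Nonempty M] (g : Metric n M) : riemVol g ≠ 0 := by
  intro h
  have h0 : ∀ p, chartVolume g p (refChart n M ⁻¹' {p}) = 0 := fun p => by
    have h1 := Measure.le_sum (fun p : M => (chartVolume g p).restrict (refChart n M ⁻¹' {p})) p
      Set.univ
    rw [← riemVol, h] at h1
    simpa using h1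
  obtain ⟨x₀⟩ := ‹Nonempty M›
  set φ := fun p : M => extChartAt (𝓡 n) p
  have hpos : 0 < (volume : Measure (EuclideanSpace ℝ (Fin n))) (φ x₀).target :=
    (isOpen_extChartAt_target x₀).measure_pos _ ⟨_, mem_extChartAt_target x₀⟩
  refine hpos.ne' (measure_mono_null (t := ⋃ p ∈ Set.range (refChart n M),
    (φ x₀ ∘ (φ p).symm) '' (((φ p).symm ⁻¹' (refChart n M ⁻¹' {p}) ∩ (φ p).target) ∩
      ((φ p).symm ≫ φ x₀).source)) ?_ ?_)
  · intro y hy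
    set q := refChart n M ((φ x₀).symm y) with hq
    have hx : (φ x₀).symm y ∈ (φ q).source := by
      have := preimage_refChart_subset (n := n) q (show (φ x₀).symm y ∈ _ from rfl)
      rwa [← extChartAt_source (𝓡 n)] at this
    have hl : (φ q).symm (φ q ((φ x₀).symm y)) = (φ x₀).symm y := (φ q).left_inv hx
    have ht := (φ q).map_source hx
    refine Set.mem_iUnion₂.2 ⟨q, ⟨_, rfl⟩, φ q ((φ x₀).symm y), ⟨⟨?_, ht⟩, ht, ?_⟩, ?_⟩
    · change refChart n M ((φ q).symm (φ q _)) = q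
      rw [hl]
    · change (φ q).symm (φ q _) ∈ (φ x₀).source
      rw [hl]
      exact (φ x₀).map_target hy
    · change φ x₀ ((φ q).symm (φ q _)) = y
      rw [hl]
      exact (φ x₀).right_inv hy
  · refine (measure_biUnion_null_iff (refChart_spec n M).1.countable).2 fun p _ => ?_
    refine addHaar_image_eq_zero_of_differentiableOn_of_addHaar_eq_zero _
      (((contDiffOn_ext_coord_change (n := ∞) x₀ p).differentiableOn (by simp)).mono
        Set.inter_subset_right) (measure_mono_null Set.inter_subset_left ?_)
    exact volume_eq_zero_of_chartVolume_eq_zero g p (measurableSet_refChart p) (h0 p)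

/-- On each of the finitely many pieces the function agrees with one that is continuous on a compact
set containing the piece. Thus the coordinate invariance of curvature never enters. -/
theorem integrable_riemVol_of_chartwise (g : Metric n M) {f : M → ℝ} {F : M → M → ℝ}
    (hF : ∀ p, ContinuousOn (F p) (chartAt (EuclideanSpace ℝ (Fin n)) p).source)
    (hf : ∀ x, f x = F (refChart n M x) x) : Integrable f (riemVol g) := by
  have huniv : (Set.univ : Set M) = ⋃ p ∈ Set.range (refChart n M), refChart n M ⁻¹' {p} := by
    ext x; simp
  rw [← integrableOn_univ, huniv, integrableOn_finite_biUnion (refChart_spec n M).1]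
  intro p _
  obtain ⟨hm, K, hK, h1, h2⟩ := (refChart_spec n M).2 p
  have h3 : IntegrableOn (F p) (refChart n M ⁻¹' {p}) (riemVol g) :=
    (((hF p).mono h2).integrableOn_compact hK).mono_set h1
  refine h3.congr_fun (fun x hx => ?_) hm
  rw [hf x, show refChart n M x = p from hx]

theorem riemVol_const_smul {g g' : Metric n M} {a : ℝ} (ha : 0 < a)
    (h : ∀ p y, metricMatrix g' p y = a • metricMatrix g p y) :
    riemVol g' = ENNReal.ofReal (Real.sqrt (a ^ n)) • riemVol g := by
  have h1 : ∀ p, chartVolume g' p = ENNReal.ofReal (Real.sqrt (a ^ n)) • chartVolume g p := by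
    intro p
    have h2 : (fun y => ENNReal.ofReal (Real.sqrt (metricMatrix g' p y).det)) =
        ENNReal.ofReal (Real.sqrt (a ^ n)) •
          fun y => ENNReal.ofReal (Real.sqrt (metricMatrix g p y).det) := by
      funext y
      rw [h, Matrix.det_smul, Fintype.card_fin, Real.sqrt_mul (by positivity),
        ENNReal.ofReal_mul (Real.sqrt_nonneg _)]
      rfl
    rw [chartVolume, h2, withDensity_smul' _ _ ENNReal.ofReal_ne_top, Measure.map_smul]
    rfl
  ext s hs
  simp only [riemVol, Measure.sum_apply _ hs, h1, Measure.restrict_smul, Measure.smul_apply,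
    smul_eq_mul, ENNReal.tsum_mul_left]

end Metric

end

section

variable {n : ℕ} {M : Type*} [TopologicalSpace M] [ChartedSpace (EuclideanSpace ℝ (Fin n)) M]
  [IsManifold (𝓡 n) ∞ M]

/-- The product of a positive smooth function with a positive constant. -/
def PosSmooth.constMul (c : ℝ) (hc : 0 < c) (u : PosSmooth n M) : PosSmooth n M where
  toFun x := c * u.toFun x
  smooth := contMDiff_const.mul u.smooth
  pos x := mul_pos hc (u.pos x)

instance : Nonempty (PosSmooth n M) := ⟨⟨fun _ => 1, contMDiff_const, fun _ => one_pos⟩⟩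

theorem metricMatrix_conformal (S : SMMS n M) (u : PosSmooth n M) (p : M)
    (y : EuclideanSpace ℝ (Fin n)) :
    metricMatrix (S.conformal u).g p y =
      ((u.toFun ((extChartAt (𝓡 n) p).symm y)) ^ 2)⁻¹ • metricMatrix S.g p y :=
  rfl

namespace SMMS

/-! ### Integrability and positivity -/

theorem continuous_rpow_v (S : SMMS n M) (q : ℝ) : Continuous fun x => S.v x ^ q :=
  S.v_smooth.continuous.rpow_const fun x => Or.inl (S.v_pos x).ne'

theorem contDiffOn_v_coord (S : SMMS n M) (p : M) :
    ContDiffOn ℝ ∞ (S.v ∘ (extChartAt (𝓡 n) p).symm) (extChartAt (𝓡 n) p).target :=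
  (S.v_smooth.comp_contMDiffOn (contMDiffOn_extChartAt_symm p)).contDiffOn

variable [CompactSpace M] [T2Space M] [MeasurableSpace M] [BorelSpace M]

theorem integrable_rpow_v (S : SMMS n M) (q : ℝ) :
    Integrable (fun x => S.v x ^ q) (riemVol S.g) :=
  integrable_riemVol_of_chartwise S.g (F := fun _ x => S.v x ^ q)
    (fun _ => (S.continuous_rpow_v q).continuousOn) fun _ => rfl

theorem integral_rpow_v_pos [Nonempty M] (S : SMMS n M) (q : ℝ) :
    0 < ∫ x, S.v x ^ q ∂(riemVol S.g) := by
  have hpos : ∀ x, 0 < S.v x ^ q := fun x => Real.rpow_pos_of_pos (S.v_pos x) q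
  refine (integral_pos_iff_support_of_nonneg (fun x => (hpos x).le) (S.integrable_rpow_v q)).2 ?_
  rw [show Function.support (fun x => S.v x ^ q) = Set.univ from
    Set.eq_univ_of_forall fun x => (hpos x).ne']
  exact Measure.measure_univ_pos.2 (riemVol_ne_zero S.g)

theorem weightedVol_pos [Nonempty M] (S : SMMS n M) : 0 < S.weightedVol :=
  S.integral_rpow_v_pos _

theorem weightedVol₂_pos [Nonempty M] (S : SMMS n M) : 0 < S.weightedVol₂ :=
  S.integral_rpow_v_pos _

theorem integrable_weightedScalar_mul (S : SMMS n M) :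
    Integrable (fun x => S.weightedScalar x * S.v x ^ S.m) (riemVol S.g) := by
  refine integrable_riemVol_of_chartwise S.g (F := fun p x =>
    (coordScalar (metricMatrix S.g p) (extChartAt (𝓡 n) p x) -
      2 * S.m * (S.v x)⁻¹ * coordLaplacian (metricMatrix S.g p)
        (S.v ∘ (extChartAt (𝓡 n) p).symm) (extChartAt (𝓡 n) p x) -
      S.m * (S.m - 1) * ((S.v x) ^ 2)⁻¹ * coordGradSq (metricMatrix S.g p)
        (S.v ∘ (extChartAt (𝓡 n) p).symm) (extChartAt (𝓡 n) p x)) * S.v x ^ S.m)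
    (fun p => ?_) fun x => rfl
  rw [← extChartAt_source (𝓡 n)]
  have hU := isOpen_extChartAt_target (I := 𝓡 n) p
  have hG := contDiffOn_metricMatrix S.g p
  have hdet : ∀ y ∈ (extChartAt (𝓡 n) p).target, (metricMatrix S.g p y).det ≠ 0 :=
    fun y hy => (metricMatrix_det_pos S.g p hy).ne'
  have hφ := continuousOn_extChartAt (I := 𝓡 n) p
  have hmaps : Set.MapsTo (extChartAt (𝓡 n) p) (extChartAt (𝓡 n) p).source
      (extChartAt (𝓡 n) p).target := fun x hx => (extChartAt (𝓡 n) p).map_source hx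
  have h1 := (contDiffOn_coordScalar hU hG hdet).continuousOn.comp hφ hmaps
  have h2 := (contDiffOn_coordLaplacian hU hG hdet (S.contDiffOn_v_coord p)).continuousOn.comp
    hφ hmaps
  have h3 := (contDiffOn_coordGradSq hU hG hdet (S.contDiffOn_v_coord p)).continuousOn.comp
    hφ hmaps
  have h4 : Continuous fun x => (S.v x)⁻¹ :=
    S.v_smooth.continuous.inv₀ fun x => (S.v_pos x).ne'
  have h5 : Continuous fun x => ((S.v x) ^ 2)⁻¹ :=
    (S.v_smooth.continuous.pow 2).inv₀ fun x => pow_ne_zero 2 (S.v_pos x).ne'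
  exact ((h1.sub ((continuous_const.mul h4).continuousOn.mul h2)).sub
    ((continuous_const.mul h5).continuousOn.mul h3)).mul (S.continuous_rpow_v S.m).continuousOn

theorem energyFunctional_eq (S : SMMS n M) (μ : ℝ) :
    S.energyFunctional μ = S.totalScalar + S.m * μ * S.weightedVol₂ := by
  rw [totalScalar, weightedVol₂, ← integral_const_mul, ← integral_add
    S.integrable_weightedScalar_mul ((S.integrable_rpow_v _).const_mul _)]
  refine integral_congr_ae (Filter.Eventually.of_forall fun x => ?_)
  have hx := S.v_pos x
  simp only [Real.rpow_sub hx, Real.rpow_two]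
  ring

/-! ### Scaling by constants -/

section Scaling

variable {S T : SMMS n M} {a b : ℝ}

/-- The terms `v⁻¹ Δv` and `v⁻² |∇v|²` are homogeneous of degree zero in `v`, so `b` drops out. -/
theorem weightedScalar_scaling (ha : 0 < a) (hb : 0 < b)
    (hg : ∀ p y, metricMatrix T.g p y = a • metricMatrix S.g p y)
    (hv : ∀ x, T.v x = b * S.v x) (hm : T.m = S.m) (x : M) :
    T.weightedScalar x = a⁻¹ * S.weightedScalar x := by
  have hv' : ∀ p : M, T.v ∘ (extChartAt (𝓡 n) p).symm =
      fun z => b * (S.v ∘ (extChartAt (𝓡 n) p).symm) z := fun p => funext fun z => hv _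
  have hx := S.v_pos x
  simp only [weightedScalar, scalarCurv, laplacian, gradSq, hv', hv, hm,
    coordScalar_const_smul ha.ne' (hg _), coordLaplacian_const_smul ha.ne' (hg _),
    coordGradSq_const_smul ha.ne' (hg _)]
  field_simp

theorem integral_riemVol_scaling (ha : 0 < a)
    (hg : ∀ p y, metricMatrix T.g p y = a • metricMatrix S.g p y) (f : M → ℝ) :
    ∫ x, f x ∂(riemVol T.g) = Real.sqrt (a ^ n) * ∫ x, f x ∂(riemVol S.g) := by
  rw [riemVol_const_smul ha hg, integral_smul_measure, ENNReal.toReal_ofReal (Real.sqrt_nonneg _),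
    smul_eq_mul]

theorem integral_rpow_v_scaling (ha : 0 < a) (hb : 0 < b)
    (hg : ∀ p y, metricMatrix T.g p y = a • metricMatrix S.g p y)
    (hv : ∀ x, T.v x = b * S.v x) (q : ℝ) :
    ∫ x, T.v x ^ q ∂(riemVol T.g) =
      Real.sqrt (a ^ n) * b ^ q * ∫ x, S.v x ^ q ∂(riemVol S.g) := by
  simp only [integral_riemVol_scaling ha hg, hv, Real.mul_rpow hb.le (S.v_pos _).le,
    integral_const_mul, mul_assoc]

theorem totalScalar_scaling (ha : 0 < a) (hb : 0 < b)
    (hg : ∀ p y, metricMatrix T.g p y = a • metricMatrix S.g p y)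
    (hv : ∀ x, T.v x = b * S.v x) (hm : T.m = S.m) :
    T.totalScalar = a⁻¹ * (Real.sqrt (a ^ n) * b ^ S.m) * S.totalScalar := by
  have h : ∀ x, T.weightedScalar x * T.v x ^ T.m =
      (a⁻¹ * b ^ S.m) * (S.weightedScalar x * S.v x ^ S.m) := fun x => by
    rw [weightedScalar_scaling ha hb hg hv hm, hv, hm, Real.mul_rpow hb.le (S.v_pos _).le]
    ring
  rw [totalScalar, totalScalar, integral_riemVol_scaling ha hg]
  simp only [h, integral_const_mul]
  ring

end Scaling

/-! ### Reduction to a one-parameter family of scales -/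

theorem yamabe_scaling_identity {n : ℕ} (hn : 0 < n) {m A B C b c : ℝ} (hB : 0 < B) (hC : 0 < C)
    (hb : 0 < b) (hc : 0 < c) (h : (c ^ n)⁻¹ * b ^ m * C = 1) :
    c ^ 2 * ((c ^ n)⁻¹ * b ^ m) * A + m * ((c ^ n)⁻¹ * b ^ (m - 2) * B) =
      A * B ^ (m / n) / C ^ ((m + n - 2) / n) * (b ^ 2 * C / B) ^ (m / n) +
        m / (b ^ 2 * C / B) := by
  have hn' : (0 : ℝ) < n := by exact_mod_cast hn
  -- The volume constraint leaves the left side equal to `c² A / C + m B / (b² C)`. The second term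
  -- is already `m / x`; writing `c²` as `(b^m C)^(2/n)` matches the first with the quotient times
  -- `x^(m/n)`.
  have hcn : c ^ n = b ^ m * C := by
    field_simp at h
    linarith
  have hbm : 0 < b ^ m := Real.rpow_pos_of_pos hb m
  have hc2 : c ^ 2 = (b ^ m) ^ (2 / n : ℝ) * C ^ (2 / n : ℝ) := by
    rw [← Real.mul_rpow hbm.le hC.le, ← hcn, ← Real.rpow_natCast c n, ← Real.rpow_mul hc.le,
      mul_div_cancel₀ _ hn'.ne', Real.rpow_two]
  have hb2 : (b ^ 2) ^ (m / n) = (b ^ m) ^ (2 / n : ℝ) := by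
    rw [← Real.rpow_two, ← Real.rpow_mul hb.le, ← Real.rpow_mul hb.le]
    congr 1
    ring
  have hCe : C ^ ((m + n - 2) / n) = C ^ (m / n) * C / C ^ (2 / n : ℝ) := by
    rw [show (m + n - 2) / n = m / n + 1 - 2 / n by field_simp, Real.rpow_sub hC,
      Real.rpow_add hC, Real.rpow_one]
  rw [Real.div_rpow (by positivity) hB.le, Real.mul_rpow (by positivity) hC.le, hb2, hCe,
    Real.rpow_sub hb, Real.rpow_two, hc2, hcn]
  have h1 := (Real.rpow_pos_of_pos hbm (2 / n : ℝ)).ne'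
  have h2 := (Real.rpow_pos_of_pos hC (2 / n : ℝ)).ne'
  have h3 := (Real.rpow_pos_of_pos hC (m / n : ℝ)).ne'
  have h4 := (Real.rpow_pos_of_pos hB (m / n : ℝ)).ne'
  field_simp

theorem energyFunctional_of_scaling [Nonempty M] (hn : 0 < n) {S T : SMMS n M} {b c : ℝ}
    (hb : 0 < b) (hc : 0 < c)
    (hg : ∀ p y, metricMatrix T.g p y = (c ^ 2)⁻¹ • metricMatrix S.g p y)
    (hv : ∀ x, T.v x = b * S.v x) (hm : T.m = S.m) :
    T.weightedVol = (c ^ n)⁻¹ * b ^ S.m * S.weightedVol ∧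
    (T.weightedVol = 1 → T.energyFunctional 1 =
      S.yamabeQuotient * (b ^ 2 * S.weightedVol / S.weightedVol₂) ^ (S.m / n) +
        S.m / (b ^ 2 * S.weightedVol / S.weightedVol₂)) := by
  have ha : 0 < (c ^ 2)⁻¹ := by positivity
  have hs : Real.sqrt ((c ^ 2)⁻¹ ^ n) = (c ^ n)⁻¹ := by
    rw [show (c ^ 2)⁻¹ ^ n = ((c ^ n)⁻¹) ^ 2 by rw [inv_pow, inv_pow, pow_right_comm]]
    exact Real.sqrt_sq (by positivity)
  have hV : T.weightedVol = (c ^ n)⁻¹ * b ^ S.m * S.weightedVol := by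
    rw [weightedVol, hm, integral_rpow_v_scaling ha hb hg hv, hs]
    rfl
  refine ⟨hV, fun h1 => ?_⟩
  have hV2 : T.weightedVol₂ = (c ^ n)⁻¹ * b ^ (S.m - 2) * S.weightedVol₂ := by
    rw [weightedVol₂, hm, integral_rpow_v_scaling ha hb hg hv, hs]
    rfl
  rw [energyFunctional_eq, totalScalar_scaling ha hb hg hv hm, hV2, hs, hm, inv_inv, mul_one]
  exact yamabe_scaling_identity hn S.weightedVol₂_pos S.weightedVol_pos hb hc (hV ▸ h1)

theorem mEnergy_eq_iInf [Nonempty M] (hn : 0 < n) (S : SMMS n M) :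
    S.mEnergy = ⨅ (u : PosSmooth n M) (x : ℝ) (_ : 0 < x),
      (((S.conformal u).yamabeQuotient * x ^ (S.m / n) + S.m / x : ℝ) : EReal) := by
  apply le_antisymm
  · refine le_iInf fun u => le_iInf₂ fun x hx => ?_
    set T := S.conformal u with hT
    have hB := T.weightedVol₂_pos
    have hC := T.weightedVol_pos
    -- Here `b` realizes the prescribed `x`, and `c` below normalizes the weighted volume.
    set b := Real.sqrt (x * T.weightedVol₂ / T.weightedVol) with hbdef
    have hb : 0 < b := Real.sqrt_pos.2 (by positivity)
    have hb2 : b ^ 2 * T.weightedVol / T.weightedVol₂ = x := by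
      rw [hbdef, Real.sq_sqrt (by positivity)]
      field_simp
    have hbC : 0 < b ^ S.m * T.weightedVol := mul_pos (Real.rpow_pos_of_pos hb _) hC
    set c := (b ^ S.m * T.weightedVol) ^ ((n : ℝ)⁻¹) with hcdef
    have hc : 0 < c := Real.rpow_pos_of_pos hbC _
    have hcn : c ^ n = b ^ S.m * T.weightedVol := Real.rpow_inv_natCast_pow hbC.le hn.ne'
    have hk : Real.sqrt ((b * c) ^ 2) = b * c := Real.sqrt_sq (by positivity)
    have hτ : 0 < (b * c) ^ 2 := by positivity
    -- With `τ = (bc)²` and conformal factor `c u`, the metric is `c⁻²` times that of `T` and the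
    -- density function is `(bc)/c = b` times that of `T`.
    set T' := (S.rescale (Real.sqrt ((b * c) ^ 2)) (Real.sqrt_pos.2 hτ)).conformal
      (u.constMul c hc) with hT'
    have hg : ∀ p y, metricMatrix T'.g p y = (c ^ 2)⁻¹ • metricMatrix T.g p y := fun p y => by
      rw [hT', hT, metricMatrix_conformal, metricMatrix_conformal, smul_smul, ← mul_inv, ← mul_pow]
      rfl
    have hv : ∀ x, T'.v x = b * T.v x := fun x => by
      change (c * u.toFun x)⁻¹ * (Real.sqrt ((b * c) ^ 2) * S.v x) =
        b * ((u.toFun x)⁻¹ * S.v x)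
      have := u.pos x
      rw [hk]
      field_simp
    obtain ⟨h1, h2⟩ := energyFunctional_of_scaling hn hb hc hg hv rfl
    have h3 : T'.weightedVol = 1 := by
      rw [h1, hcn, mul_assoc]
      exact inv_mul_cancel₀ hbC.ne'
    refine (iInf₂_le ((b * c) ^ 2) hτ).trans ((iInf₂_le (u.constMul c hc) h3).trans ?_)
    rw [h2 h3, hb2]
    rfl
  -- Conversely, a normalized competitor is the scaling with `b = √τ` and `c = 1`.
  · refine le_iInf₂ fun τ hτ => le_iInf₂ fun u hu => ?_
    set T := S.conformal u with hT
    have hk := Real.sqrt_pos.2 hτ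
    have h := (energyFunctional_of_scaling hn (S := T)
      (T := (S.rescale (Real.sqrt τ) hk).conformal u) (b := Real.sqrt τ) (c := 1) hk one_pos
      (fun p y => ?_) (fun x => ?_) rfl).2 hu
    · rw [h]
      exact iInf_le_of_le u (iInf₂_le _ (by
        have hB := T.weightedVol₂_pos
        have hC := T.weightedVol_pos
        positivity))
    · rw [one_pow, inv_one, one_smul]
      rfl
    · exact mul_left_comm _ _ _

end SMMS

end

section

variable {n : ℕ} {M : Type*} [TopologicalSpace M] [ChartedSpace (EuclideanSpace ℝ (Fin n)) M]
  [IsManifold (𝓡 n) ∞ M] [CompactSpace M] [T2Space M] [MeasurableSpace M] [BorelSpace M]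

/-! ### Minimization over the scale -/

/-- Weighted AM-GM for `(σ/n) x^(m/n)` and `x⁻¹`, with weights `n/(m+n)` and `m/(m+n)` chosen so
that the powers of `x` cancel in the geometric mean. -/
theorem le_mul_rpow_add_div {n m σ x : ℝ} (hn : 0 < n) (hm : 0 ≤ m) (hσ : 0 ≤ σ) (hx : 0 < x) :
    (m + n) * (σ / n) ^ (n / (m + n)) ≤ σ * x ^ (m / n) + m / x := by
  have hmn : 0 < m + n := by positivity
  have h := Real.geom_mean_le_arith_mean2_weighted (w₁ := n / (m + n)) (w₂ := m / (m + n))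
    (p₁ := σ / n * x ^ (m / n)) (p₂ := x⁻¹) (by positivity) (by positivity)
    (mul_nonneg (by positivity) (Real.rpow_nonneg hx.le _)) (by positivity) (by field_simp; ring)
  have hx' : (x ^ (m / n)) ^ (n / (m + n)) * x⁻¹ ^ (m / (m + n)) = 1 := by
    rw [← Real.rpow_mul hx.le, Real.inv_rpow hx.le,
      show m / n * (n / (m + n)) = m / (m + n) by field_simp]
    exact mul_inv_cancel₀ (Real.rpow_pos_of_pos hx _).ne'
  rw [Real.mul_rpow (by positivity) (Real.rpow_nonneg hx.le _), mul_assoc, hx', mul_one] at h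
  calc (m + n) * (σ / n) ^ (n / (m + n))
      ≤ (m + n) * (n / (m + n) * (σ / n * x ^ (m / n)) + m / (m + n) * x⁻¹) := by gcongr
    _ = σ * x ^ (m / n) + m / x := by field_simp

/-- The equality case of AM-GM: at `x = (σ/n)^(-n/(m+n))` both averaged quantities equal
`(σ/n)^(n/(m+n))`. -/
theorem mul_rpow_add_div_eq {n m σ : ℝ} (hn : 0 < n) (hm : 0 ≤ m) (hσ : 0 < σ) :
    σ * ((σ / n) ^ (-(n / (m + n)))) ^ (m / n) + m / (σ / n) ^ (-(n / (m + n))) =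
      (m + n) * (σ / n) ^ (n / (m + n)) := by
  have hmn : 0 < m + n := by positivity
  have hs : 0 < σ / n := by positivity
  have h : (σ / n) * ((σ / n) ^ (-(n / (m + n)))) ^ (m / n) = (σ / n) ^ (n / (m + n)) := by
    rw [← Real.rpow_mul hs.le, ← Real.rpow_one_add' hs.le]
    · congr 1
      field_simp
      ring
    · have : 1 + -(n / (m + n)) * (m / n) = n / (m + n) := by field_simp; ring
      rw [this]
      positivity
  have h' : σ * ((σ / n) ^ (-(n / (m + n)))) ^ (m / n) = n * (σ / n) ^ (n / (m + n)) := by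
    rw [← h]
    field_simp
  rw [h', Real.rpow_neg hs.le, div_inv_eq_mul]
  ring

theorem exists_mul_rpow_add_div_lt {q r m : ℝ} (hq : q < 0) (hr : 0 < r) (hm : 0 ≤ m) (y : ℝ) :
    ∃ x : ℝ, 0 < x ∧ q * x ^ r + m / x < y := by
  have h := (tendsto_rpow_atTop hr).const_mul_atTop_of_neg hq
  obtain ⟨x, hx, hx1⟩ := ((h.eventually_lt_atBot (y - m)).and
    (Filter.eventually_ge_atTop 1)).exists
  have : m / x ≤ m := div_le_self hm hx1
  exact ⟨x, by linarith, by linarith⟩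

/-! ### The three signs of the weighted Yamabe constant -/

namespace SMMS

theorem weightedYamabe_lt_top (S : SMMS n M) : S.weightedYamabe < ⊤ :=
  (iInf_le _ (Classical.arbitrary (PosSmooth n M))).trans_lt (EReal.coe_lt_top _)

variable [Nonempty M]

theorem mEnergy_eq_bot (hn : 0 < n) (S : SMMS n M) (hm : 0 < S.m) (hS : S.weightedYamabe < 0) :
    S.mEnergy = ⊥ := by
  obtain ⟨u, hu⟩ := iInf_lt_iff.1 hS
  rw [mEnergy_eq_iInf hn, EReal.eq_bot_iff_forall_lt]
  intro y
  obtain ⟨x, hx, hxy⟩ := exists_mul_rpow_add_div_lt (EReal.coe_neg'.1 hu)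
    (div_pos hm (Nat.cast_pos.2 hn)) hm.le y
  exact (iInf_le_of_le u (iInf₂_le x hx)).trans_lt (EReal.coe_lt_coe hxy)

/-- The infimum `σ` need not be attained. For fixed `x` the bound is increasing and affine in the
quotient, so conformal factors with quotient close to `σ` suffice. -/
theorem mEnergy_le (hn : 0 < n) (S : SMMS n M) {σ : ℝ} (hσ : S.weightedYamabe = σ) {x : ℝ}
    (hx : 0 < x) : S.mEnergy ≤ ((σ * x ^ (S.m / n) + S.m / x : ℝ) : EReal) := by
  by_contra! h
  obtain ⟨z, hz1, hz2⟩ := EReal.lt_iff_exists_real_btwn.1 h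
  have hxr : 0 < x ^ (S.m / n) := Real.rpow_pos_of_pos hx _
  have hlt : S.weightedYamabe < (((z - S.m / x) / x ^ (S.m / n) : ℝ) : EReal) := by
    rw [hσ, EReal.coe_lt_coe_iff, lt_div_iff₀ hxr]
    have := EReal.coe_lt_coe_iff.1 hz1
    linarith
  obtain ⟨u, hu⟩ := iInf_lt_iff.1 hlt
  rw [EReal.coe_lt_coe_iff, lt_div_iff₀ hxr] at hu
  rw [mEnergy_eq_iInf hn] at hz2
  have := EReal.coe_lt_coe_iff.1 (hz2.trans_le (iInf_le_of_le u (iInf₂_le x hx)))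
  linarith

theorem le_mEnergy (hn : 0 < n) (S : SMMS n M) (hm : 0 ≤ S.m) {σ : ℝ}
    (hσ : S.weightedYamabe = σ) (hσ0 : 0 ≤ σ) :
    (((S.m + n) * (σ / n) ^ ((n : ℝ) / (S.m + n)) : ℝ) : EReal) ≤ S.mEnergy := by
  rw [mEnergy_eq_iInf hn]
  refine le_iInf fun u => le_iInf₂ fun x hx => EReal.coe_le_coe ?_
  have hu : σ ≤ (S.conformal u).yamabeQuotient := by
    rw [← EReal.coe_le_coe_iff, ← hσ]
    exact iInf_le _ u
  have hxr : 0 < x ^ (S.m / n) := Real.rpow_pos_of_pos hx _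
  refine (le_mul_rpow_add_div (Nat.cast_pos.2 hn) hm hσ0 hx).trans ?_
  gcongr

theorem mEnergy_eq_zero (hn : 0 < n) (S : SMMS n M) (hm : 0 ≤ S.m) (hS : S.weightedYamabe = 0) :
    S.mEnergy = 0 := by
  have hn' : (0 : ℝ) < n := Nat.cast_pos.2 hn
  have hS' : S.weightedYamabe = ((0 : ℝ) : EReal) := hS
  apply le_antisymm
  · by_contra! h
    obtain ⟨z, hz1, hz2⟩ := EReal.lt_iff_exists_real_btwn.1 h
    have hz : 0 < z := EReal.coe_pos.1 hz1
    -- At this scale `m/x = z m/(m+1) < z`; the `+ 1` keeps `x` positive when `m = 0`.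
    have hx : 0 < (S.m + 1) / z := by positivity
    have h1 := EReal.coe_lt_coe_iff.1 (hz2.trans_le (S.mEnergy_le hn hS' hx))
    rw [zero_mul, zero_add, lt_div_iff₀ hx, mul_div_cancel₀ _ hz.ne'] at h1
    linarith
  · have h := S.le_mEnergy hn hm hS' le_rfl
    rwa [zero_div, Real.zero_rpow (by positivity), mul_zero] at h

theorem mEnergy_eq_of_pos (hn : 0 < n) (S : SMMS n M) (hm : 0 ≤ S.m) {σ : ℝ}
    (hS : S.weightedYamabe = σ) (hσ : 0 < σ) :
    S.mEnergy = (((S.m + n) * (σ / n) ^ ((n : ℝ) / (S.m + n)) : ℝ) : EReal) := by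
  have hn' : (0 : ℝ) < n := Nat.cast_pos.2 hn
  refine le_antisymm ?_ (S.le_mEnergy hn hm hS hσ.le)
  rw [← mul_rpow_add_div_eq hn' hm hσ]
  exact S.mEnergy_le hn hS (Real.rpow_pos_of_pos (by positivity) _)

end SMMS

end

end WeightedYamabe

end

theorem proposition3p6 {n : ℕ} (hn : 0 < n) {M : Type*} [TopologicalSpace M]
    [ChartedSpace (EuclideanSpace ℝ (Fin n)) M] [IsManifold (𝓡 n) ∞ M]
    [CompactSpace M] [T2Space M] [Nonempty M] [MeasurableSpace M] [BorelSpace M]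
    (S : WeightedYamabe.SMMS n M) (hm : 0 ≤ S.m) :
    (S.weightedYamabe < 0 → 0 < S.m → S.mEnergy = ⊥) ∧
    (S.weightedYamabe = 0 → S.mEnergy = 0) ∧
    (0 < S.weightedYamabe → ∃ σ : ℝ, S.weightedYamabe = (σ : EReal) ∧
      S.mEnergy = (((S.m + n) * (σ / n) ^ ((n : ℝ) / (S.m + n)) : ℝ) : EReal)) := by
  refine ⟨fun h hm' => S.mEnergy_eq_bot hn hm' h, fun h => S.mEnergy_eq_zero hn hm h, fun h => ?_⟩
  -- Positivity excludes `⊥`, and any single conformal factor excludes `⊤`, so the constant is real.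
  have hS : S.weightedYamabe = ((S.weightedYamabe.toReal : ℝ) : EReal) :=
    (EReal.coe_toReal S.weightedYamabe_lt_top.ne (bot_le.trans_lt h).ne').symm
  exact ⟨_, hS, S.mEnergy_eq_of_pos hn hm hS (EReal.toReal_pos h S.weightedYamabe_lt_top.ne)⟩
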